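/- Let $m\ge 0$ be an integer, let $a,b,c_1,\dots,c_m\in\mathbb{C}$ be arbitrary, and let $D=\mathbb{C}\langle x_1,\dots,x_m,\partial_1,\dots,\partial_m\rangle$ be the Weyl algebra in $m$ variables. Put $\theta_i=x_i\partial_i$ and $\theta=\theta_1+\cdots+\theta_m$, and let $I(m)$ be the left ideal of $D$ generated by the Lauricella $F_C$ operators $$\ell_i=\theta_i(\theta_i+c_i-1)-x_i(\theta+a)(\theta+b),\qquad i=1,\dots,m.$$ For $p=\sum c_{\alpha,\beta}x^\alpha\partial^\beta\in D$, the principal symbol of $p$ is the sum of those $c_{\alpha,\beta}x^\alpha\xi^\beta\in\mathbb{C}[x_1,\dots,x_m,\xi_1,\dots,\xi_m]$ with $c_{\alpha,\beta}\ne 0$ for which $|\beta|=\beta_1+\cdots+\beta_m$ is maximal. For a left ideal $I$ of $D$, the characteristic ideal of $I$ is the ideal of $\mathbb{C}[x,\xi]$ generated by the principal symbols of all elements of $I$; the characteristic variety $\mathrm{Ch}(I)\subset\mathbb{C}^{2m}$ is its zero set; and the singular locus $\mathrm{Sing}(I)\subset\mathbb{C}^m$ is the image of $\mathrm{Ch}(I)\setminus\{\xi=0\}$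 under the projection $(x,\xi)\mapsto x$. Theorem. In the complex torus $(\mathbb{C}^*)^m$, the singular locus of $I(m)$ agrees with the zero set of $$\prod_{i=1}^m x_i\prod_{\varepsilon\in\{-1,1\}^m}\bigl(1+\varepsilon_1\sqrt{x_1}+\cdots+\varepsilon_m\sqrt{x_m}\bigr),$$ that is, the two sets have the same intersection with $(\mathbb{C}^*)^m$. Here $\sqrt{\ }$ denotes any choice of a square root of each complex number; the product over all signs does not depend on this choice. -/

import Mathlib

noncomputable section

namespace Lauricella

open MvPolynomial

/-- The Weyl algebra `D = ℂ⟨x₁, …, x_m, ∂₁, …, ∂_m⟩`, realised (as is standard in characteristic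
zero) as the algebra of operators on the polynomial ring `ℂ[x₁, …, x_m]` generated by the
multiplications by the variables and the partial derivatives. -/
def weylAlgebra (m : ℕ) : Subalgebra ℂ (Module.End ℂ (MvPolynomial (Fin m) ℂ)) :=
  Algebra.adjoin ℂ
    (Set.range (fun i : Fin m => LinearMap.mulLeft ℂ (X i : MvPolynomial (Fin m) ℂ)) ∪
      Set.range (fun i : Fin m =>
        ((pderiv i : Derivation ℂ (MvPolynomial (Fin m) ℂ) (MvPolynomial (Fin m) ℂ)) :
          Module.End ℂ (MvPolynomial (Fin m) ℂ))))

/-- The Weyl algebra as a type; `Ideal (D m)` is the type of its left ideals. -/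
abbrev D (m : ℕ) : Type := weylAlgebra m

variable {m : ℕ}

/-- The operator of multiplication by `xᵢ`. -/
def x (i : Fin m) : D m :=
  ⟨LinearMap.mulLeft ℂ (X i), Algebra.subset_adjoin (Or.inl ⟨i, rfl⟩)⟩

/-- The operator `∂ᵢ`. -/
def d (i : Fin m) : D m :=
  ⟨((pderiv i : Derivation ℂ (MvPolynomial (Fin m) ℂ) (MvPolynomial (Fin m) ℂ)) :
      Module.End ℂ (MvPolynomial (Fin m) ℂ)), Algebra.subset_adjoin (Or.inr ⟨i, rfl⟩)⟩

/-- The polynomial ring `ℂ[x₁, …, x_m, ξ₁, …, ξ_m]`: `Sum.inl i` is the index of the variable `xᵢ`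
and `Sum.inr i` that of the variable `ξᵢ`. -/
abbrev SymbolRing (m : ℕ) : Type := MvPolynomial (Fin m ⊕ Fin m) ℂ

/-- The normally ordered operator `x^α ∂^β`. -/
def normalMonomial (α β : Fin m → ℕ) : D m :=
  (List.ofFn fun i => x i ^ α i).prod * (List.ofFn fun i => d i ^ β i).prod

/-- The operator `∑ c_{α,β} x^α ∂^β` attached to the polynomial `∑ c_{α,β} x^α ξ^β`. -/
def normalOrder (P : SymbolRing m) : D m :=
  ∑ e ∈ P.support, P.coeff e • normalMonomial (fun i => e (Sum.inl i)) (fun i => e (Sum.inr i))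

/-- The weight vector `(0, 1)`: weight `0` on the `xᵢ` and weight `1` on the `ξᵢ`. -/
def orderWeight (m : ℕ) : Fin m ⊕ Fin m → ℕ := Sum.elim (fun _ => 0) (fun _ => 1)

/-- The sum of the terms of highest `(0, 1)`-weight. -/
def initialForm (P : SymbolRing m) : SymbolRing m :=
  weightedHomogeneousComponent (orderWeight m) (weightedTotalDegree (orderWeight m) P) P

/-- `f` is the principal symbol of `p`: writing `p = ∑ c_{α,β} x^α ∂^β`, the polynomial `f` is the
sum of the `c_{α,β} x^α ξ^β` with `|β|` maximal. -/
def IsPrincipalSymbol (p : D m) (f : SymbolRing m) : Prop :=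
  ∃ P : SymbolRing m, normalOrder P = p ∧ initialForm P = f

/-- The characteristic ideal of a left ideal `I`: the ideal generated by the principal symbols of
all elements of `I`. -/
def characteristicIdeal (I : Ideal (D m)) : Ideal (SymbolRing m) :=
  Ideal.span {f | ∃ p ∈ I, IsPrincipalSymbol p f}

/-- The characteristic variety of `I`, as a set of pairs `(x, ξ)`. -/
def characteristicVariety (I : Ideal (D m)) : Set ((Fin m → ℂ) × (Fin m → ℂ)) :=
  {q | ∀ f ∈ characteristicIdeal I, eval (Sum.elim q.1 q.2) f = 0}

/-- The singular locus of `I`: the projection to the `x`-space of the characteristic variety minus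
the zero section `ξ = 0`. -/
def singularLocus (I : Ideal (D m)) : Set (Fin m → ℂ) :=
  Prod.fst '' (characteristicVariety I \ {q | q.2 = 0})

/-- `θᵢ = xᵢ ∂ᵢ`. -/
def theta (i : Fin m) : D m := x i * d i

/-- `θ = θ₁ + ⋯ + θ_m`. -/
def thetaSum (m : ℕ) : D m := ∑ i, theta i

/-- `ℓᵢ = θᵢ (θᵢ + cᵢ - 1) - xᵢ (θ + a) (θ + b)`. -/
def lauricellaOperator (a b : ℂ) (c : Fin m → ℂ) (i : Fin m) : D m :=
  theta i * (theta i + algebraMap ℂ (D m) (c i) - 1) -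
    x i * (thetaSum m + algebraMap ℂ (D m) a) * (thetaSum m + algebraMap ℂ (D m) b)

/-- The left ideal `I(m)` generated by `ℓ₁, …, ℓ_m`. -/
def lauricellaIdeal (a b : ℂ) (c : Fin m → ℂ) : Ideal (D m) :=
  Ideal.span (Set.range (lauricellaOperator a b c))

/-- The complex torus `(ℂ*)^m`. -/
def complexTorus (m : ℕ) : Set (Fin m → ℂ) := {z | ∀ i, z i ≠ 0}

end Lauricella

end

/-!
Write `Aᵢ = ∂ᵢ (θᵢ + cᵢ - 1)` and `B = (θ + a) (θ + b)`, so that `ℓᵢ = xᵢ (Aᵢ - B)`, and let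
`s = ∑ⱼ xⱼ ξⱼ`. The principal symbol of `ℓᵢ` is `xᵢ (xᵢ ξᵢ² - s²)`. At a point of the
characteristic variety over the torus with `ξ ≠ 0` this gives `√xᵢ ξᵢ = ± s` with `s ≠ 0`, and
`s = ∑ √xᵢ (√xᵢ ξᵢ)` becomes `1 + ∑ εᵢ √xᵢ = 0` for suitable signs
(`exists_sign_of_mem_singularLocus`).

Conversely, if `1 + ∑ εᵢ √xᵢ = 0`, then `ξᵢ = εᵢ / √xᵢ` satisfies `xᵢ ξᵢ² = s²` for all `i`. It
remains to see that the principal symbol of *every* element of the ideal vanishes at `(x, ξ)`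
(`mem_characteristicVariety`), and for this it suffices to treat the larger left ideal generated by
the `Aᵢ - B`. Fix an index `o`. That ideal is generated by `gᵢ = Aᵢ - A_o` for `i ≠ o` and
`g_o = B - A_o`, and

* for the weights `4, 1` on `x_o, ξ_o` and `0, 4` on the other `xᵢ, ξᵢ`, the leading terms of the
  symbols of the `gᵢ` are the pairwise coprime monomials `xᵢ ξᵢ²` and `x_o² ξ_o²`. The same holds
  after adding any `K` to the weights of all `ξᵢ`;
* the commutators are `[gᵢ, gⱼ] = 0` and `[gᵢ, g_o] = (2θ + a + b + 1) gᵢ` for `i, j ≠ o`, of lower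
  weight than expected (`generator_commutator`).

By Buchberger's argument, every element of the ideal is a combination `∑ pᵢ gᵢ` in which the
leading terms do not cancel (`exists_standard_of_mem_span`, `weightBound_of_standard`). When `K`
exceeds the weights occurring in the element, there is no drop of the order in this combination
either, so the principal symbol of the element is the component of top order of a combination of
the symbols of the `gᵢ`, all of which vanish along the line through `(x, ξ)`.

Operators are handled through the linear isomorphism `normalOrdering` from `ℂ[x, ξ]` to the Weyl
algebra, and all statements on leading terms through `HasSymbol`, a calculus of symbols for an
arbitrary weight.
-/

noncomputable section

namespace Lauricella

open MvPolynomial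

variable {m : ℕ}

/-! ### Commutation relations and normal ordering -/

lemma commute_x (i j : Fin m) : Commute (x i) (x j) := by
  apply Subtype.ext
  refine LinearMap.ext fun f => ?_
  simp [x, mul_left_comm]

lemma commute_d (i j : Fin m) : Commute (d i) (d j) := by
  apply Subtype.ext
  refine LinearMap.ext fun f => ?_
  have h : ⁅(pderiv i : Derivation ℂ (MvPolynomial (Fin m) ℂ) (MvPolynomial (Fin m) ℂ)),
      (pderiv j : Derivation ℂ (MvPolynomial (Fin m) ℂ) (MvPolynomial (Fin m) ℂ))⁆ = 0 := by
    apply MvPolynomial.derivation_ext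
    intro k
    simp [Derivation.commutator_apply, pderiv_X, Pi.single_apply, apply_ite]
  have := congrArg (fun D => D f) h
  simpa [Derivation.commutator_apply, sub_eq_zero, d] using this

lemma d_mul_x (i j : Fin m) : d i * x j = x j * d i + if i = j then 1 else 0 := by
  apply Subtype.ext
  refine LinearMap.ext fun f => ?_
  by_cases h : i = j
  · subst h
    simp [x, d]
  · simp [x, d, h, pderiv_X_of_ne (Ne.symm h)]

/-- In an ordered product of powers of pairwise commuting elements, a further factor on the right
raises one exponent. -/
lemma prod_ofFn_pow_mul {M : Type*} [Monoid M] {n : ℕ} (f : Fin n → M)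
    (hf : ∀ i j, Commute (f i) (f j)) (α : Fin n → ℕ) (i : Fin n) :
    (List.ofFn fun j => f j ^ α j).prod * f i =
      (List.ofFn fun j => f j ^ (α j + (Pi.single i 1 : Fin n → ℕ) j)).prod := by
  induction n with
  | zero => exact i.elim0
  | succ n ih =>
    simp only [List.ofFn_succ, List.prod_cons]
    refine Fin.cases ?_ (fun k => ?_) i
    · have hc : Commute (List.ofFn fun j : Fin n => f j.succ ^ α j.succ).prod (f 0) := by
        apply Commute.list_prod_left
        intro y hy
        obtain ⟨j, rfl⟩ := (List.mem_ofFn' _ _).1 hy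
        exact (hf _ _).pow_left _
      rw [mul_assoc, hc.eq, ← mul_assoc, ← pow_succ]
      simp
    · rw [mul_assoc, ih (fun j => f j.succ) (fun i j => hf _ _) (fun j => α j.succ) k]
      simp [Pi.single_apply]

/-- Normal ordering `x^α ξ^β ↦ x^α ∂^β` as a linear map. -/
def normalOrdering (m : ℕ) : SymbolRing m →ₗ[ℂ] D m :=
  (basisMonomials (Fin m ⊕ Fin m) ℂ).constr ℂ fun e =>
    normalMonomial (fun i => e (Sum.inl i)) (fun i => e (Sum.inr i))

lemma normalOrdering_apply (P : SymbolRing m) : normalOrdering m P = normalOrder P := by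
  rw [normalOrdering, Module.Basis.constr_apply]
  rfl

lemma normalOrdering_monomial (e : Fin m ⊕ Fin m →₀ ℕ) (r : ℂ) :
    normalOrdering m (monomial e r) =
      r • normalMonomial (fun i => e (Sum.inl i)) (fun i => e (Sum.inr i)) := by
  have h := (basisMonomials (Fin m ⊕ Fin m) ℂ).constr_basis ℂ (fun e =>
    normalMonomial (m := m) (fun i => e (Sum.inl i)) (fun i => e (Sum.inr i))) e
  rw [coe_basisMonomials] at h
  rw [show monomial e r = r • monomial e (1 : ℂ) by simp [smul_monomial], map_smul]
  exact congrArg _ h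

lemma normalOrdering_C (r : ℂ) : normalOrdering m (C r) = algebraMap ℂ (D m) r := by
  rw [C_apply, normalOrdering_monomial]
  simp [normalMonomial, Algebra.algebraMap_eq_smul_one]

lemma normalOrdering_one : normalOrdering m 1 = 1 := by
  simpa using normalOrdering_C (m := m) 1

lemma normalOrdering_mul_d (P : SymbolRing m) (i : Fin m) :
    normalOrdering m P * d i = normalOrdering m (X (Sum.inr i) * P) := by
  induction P using MvPolynomial.induction_on' with
  | monomial e r =>
    rw [X, monomial_mul, normalOrdering_monomial, normalOrdering_monomial, one_mul, smul_mul_assoc,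
      normalMonomial, mul_assoc, prod_ofFn_pow_mul _ commute_d, normalMonomial]
    congr 4
    all_goals funext j
    · simp
    · simp [Finsupp.single_apply, Pi.single_apply, eq_comm, add_comm]
  | add P Q hP hQ => rw [map_add, add_mul, hP, hQ, mul_add, map_add]

lemma x_mul_normalOrdering (P : SymbolRing m) (i : Fin m) :
    x i * normalOrdering m P = normalOrdering m (X (Sum.inl i) * P) := by
  induction P using MvPolynomial.induction_on' with
  | monomial e r =>
    have hc : Commute (x i) (List.ofFn fun j => x j ^ e (Sum.inl j)).prod := by
      apply Commute.list_prod_right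
      intro y hy
      obtain ⟨j, rfl⟩ := (List.mem_ofFn' _ _).1 hy
      exact (commute_x _ _).pow_right _
    rw [X, monomial_mul, normalOrdering_monomial, normalOrdering_monomial, one_mul, mul_smul_comm,
      normalMonomial, ← mul_assoc, hc.eq, prod_ofFn_pow_mul _ commute_x, normalMonomial]
    congr 4
    all_goals funext j
    · simp [Finsupp.single_apply, Pi.single_apply, eq_comm, add_comm]
    · simp
  | add P Q hP hQ => rw [map_add, mul_add, hP, hQ, mul_add, map_add]

lemma normalOrdering_mul_x (P : SymbolRing m) (i : Fin m) :
    normalOrdering m P * x i =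
      normalOrdering m (X (Sum.inl i) * P + pderiv (Sum.inr i) P) := by
  induction P using MvPolynomial.induction_on with
  | C r =>
    rw [pderiv_C, add_zero, ← x_mul_normalOrdering, normalOrdering_C, Algebra.commutes]
  | add P Q hP hQ =>
    rw [map_add, add_mul, hP, hQ, ← map_add, map_add (pderiv _)]
    congr 1
    ring
  | mul_X P j hP =>
    rcases j with j | j
    · rw [mul_comm P, ← x_mul_normalOrdering, mul_assoc, hP, x_mul_normalOrdering]
      congr 1
      simp
      ring
    · rw [mul_comm P, ← normalOrdering_mul_d, mul_assoc, d_mul_x, mul_add, ← mul_assoc, hP,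
        normalOrdering_mul_d]
      have h : normalOrdering m P * (if j = i then 1 else 0) =
          normalOrdering m (if j = i then P else 0) := by split_ifs <;> simp
      rw [h, ← map_add]
      congr 1
      by_cases hj : j = i
      · subst hj
        simp
        ring
      · simp [hj]
        ring

lemma d_mul_normalOrdering (P : SymbolRing m) (i : Fin m) :
    d i * normalOrdering m P =
      normalOrdering m (X (Sum.inr i) * P + pderiv (Sum.inl i) P) := by
  induction P using MvPolynomial.induction_on with
  | C r =>
    rw [pderiv_C, add_zero, ← normalOrdering_mul_d, normalOrdering_C, Algebra.commutes]
  | add P Q hP hQ =>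
    rw [map_add, mul_add, hP, hQ, ← map_add, map_add (pderiv _)]
    congr 1
    ring
  | mul_X P j hP =>
    rcases j with j | j
    · rw [mul_comm P, ← x_mul_normalOrdering, ← mul_assoc, d_mul_x, add_mul, mul_assoc, hP,
        x_mul_normalOrdering]
      have h : (if i = j then 1 else 0) * normalOrdering m P =
          normalOrdering m (if i = j then P else 0) := by split_ifs <;> simp
      rw [h, ← map_add]
      congr 1
      by_cases hj : i = j
      · subst hj
        simp
        ring
      · simp [hj, pderiv_X_of_ne (Sum.inl_injective.ne (Ne.symm hj))]
        ring
    · rw [mul_comm P, ← normalOrdering_mul_d, ← mul_assoc, hP, normalOrdering_mul_d]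
      congr 1
      simp
      ring

/-- Commutators with `xᵢ` and `∂ᵢ` act on normally ordered operators as `∂/∂ξᵢ` and `∂/∂xᵢ`, so
the kernel of normal ordering is stable under all partial derivatives. A nonzero element of least
degree in it would therefore be constant, and nonzero constants are not in the kernel. -/
lemma normalOrdering_injective : Function.Injective (normalOrdering m) := by
  rw [injective_iff_map_eq_zero]
  have key : ∀ n (P : SymbolRing m), (∀ e ∈ P.support, e.degree < n) → normalOrdering m P = 0 →
      P = 0 := by
    intro n
    induction n with
    | zero =>
      intro P hP _
      rw [← support_eq_empty]
      exact Finset.eq_empty_of_forall_notMem fun e he => absurd (hP e he) (Nat.not_lt_zero _)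
    | succ n ih =>
      intro P hP h0
      have hpd : ∀ k, pderiv k P = 0 := by
        intro k
        apply ih
        · intro e he
          rw [mem_support_iff, coeff_pderiv] at he
          have := hP _ (mem_support_iff.2 (left_ne_zero_of_mul he))
          rw [map_add, Finsupp.degree_single] at this
          omega
        · rcases k with i | i
          · have := d_mul_normalOrdering P i
            rwa [map_add, ← normalOrdering_mul_d, h0, mul_zero, zero_mul, zero_add, eq_comm] at this
          · have := normalOrdering_mul_x P i
            rwa [map_add, ← x_mul_normalOrdering, h0, mul_zero, zero_mul, zero_add, eq_comm] at this
      have hC : P = C (P.coeff 0) := by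
        ext e
        rw [coeff_C]
        split_ifs with he
        · rw [he]
        · obtain ⟨k, hk⟩ := Finsupp.ne_iff.1 (Ne.symm he)
          rw [Finsupp.coe_zero, Pi.zero_apply] at hk
          have h1 := congrArg (coeff (e - Finsupp.single k 1)) (hpd k)
          have hle : Finsupp.single k 1 ≤ e :=
            Finsupp.single_le_iff.2 (Nat.one_le_iff_ne_zero.2 hk)
          rw [coeff_pderiv, tsub_add_cancel_of_le hle, coeff_zero, mul_eq_zero] at h1
          rcases h1 with h1 | h1
          · exact h1
          · exact absurd h1 (Nat.cast_add_one_ne_zero _)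
      rw [hC, normalOrdering_C] at h0
      have h1 : ((algebraMap ℂ (D m) (P.coeff 0) : D m) :
          Module.End ℂ (MvPolynomial (Fin m) ℂ)) 1 = 0 := by rw [h0]; rfl
      have h2 : P.coeff 0 = 0 := by
        simpa [Algebra.algebraMap_eq_smul_one] using h1
      rw [hC, h2, C_0]
  intro P h
  exact key (P.support.sup Finsupp.degree + 1) P
    (fun e he => Nat.lt_succ_of_le (Finset.le_sup (f := Finsupp.degree) he)) h

lemma normalOrdering_surjective : Function.Surjective (normalOrdering m) := by
  rintro ⟨q, hq⟩
  suffices h : ∀ P, ∃ Q, normalOrdering m Q = normalOrdering m P * ⟨q, hq⟩ by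
    simpa [normalOrdering_one] using h 1
  induction hq using Algebra.adjoin_induction with
  | mem q h =>
    intro P
    rcases h with ⟨i, rfl⟩ | ⟨i, rfl⟩
    · exact ⟨_, (normalOrdering_mul_x P i).symm⟩
    · exact ⟨_, (normalOrdering_mul_d P i).symm⟩
  | algebraMap r =>
    intro P
    refine ⟨r • P, ?_⟩
    rw [map_smul, Algebra.smul_def, Algebra.commutes]
    rfl
  | add p q hp hq ihp ihq =>
    intro P
    obtain ⟨Q, hQ⟩ := ihp P
    obtain ⟨Q', hQ'⟩ := ihq P
    exact ⟨Q + Q', by rw [map_add, hQ, hQ', ← mul_add]; rfl⟩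
  | mul p q hp hq ihp ihq =>
    intro P
    obtain ⟨Q, hQ⟩ := ihp P
    obtain ⟨Q', hQ'⟩ := ihq Q
    exact ⟨Q', by rw [hQ', hQ, mul_assoc]; rfl⟩

/-! ### Symbols with respect to a weight -/

/-- The polynomials all of whose monomials `e` satisfy `weight W e + k ≤ n`: those of weight at
most `n - k`, with the convention that only `0` has negative weight. -/
def weightBound (W : Fin m ⊕ Fin m → ℕ) (k n : ℕ) : Submodule ℂ (SymbolRing m) :=
  restrictSupport ℂ {e | Finsupp.weight W e + k ≤ n}

variable {W : Fin m ⊕ Fin m → ℕ}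

lemma mem_weightBound {k n : ℕ} {P : SymbolRing m} :
    P ∈ weightBound W k n ↔ ∀ e ∈ P.support, Finsupp.weight W e + k ≤ n :=
  Iff.rfl

lemma weightBound_mono {k l n p : ℕ} (h : l + n ≤ k + p) :
    weightBound W k n ≤ weightBound W l p := by
  intro P hP e he
  have := hP he
  simp only [Set.mem_ofPred_eq] at this ⊢
  omega

lemma mul_mem_weightBound {k l n : ℕ} {L P : SymbolRing m} (hL : L ∈ weightBound W 0 k)
    (hP : P ∈ weightBound W (k + l) n) : L * P ∈ weightBound W l n := by
  rw [mem_weightBound] at *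
  intro e he
  classical
  obtain ⟨e₁, h₁, e₂, h₂, rfl⟩ := Finset.mem_add.1 (support_mul L P he)
  have := hL _ h₁
  have := hP _ h₂
  rw [map_add]
  omega

lemma monomial_mem_weightBound {k n : ℕ} {e : Fin m ⊕ Fin m →₀ ℕ} (r : ℂ)
    (h : Finsupp.weight W e + k ≤ n) : monomial e r ∈ weightBound W k n :=
  (monomial_mem_restrictSupport ℂ).2 (Or.inl h)

lemma X_mem_weightBound (j : Fin m ⊕ Fin m) : (X j : SymbolRing m) ∈ weightBound W 0 (W j) :=
  monomial_mem_weightBound _ (by simp [Finsupp.weight_single])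

lemma pderiv_mem_weightBound {k n : ℕ} {P : SymbolRing m} (hP : P ∈ weightBound W k n)
    (j : Fin m ⊕ Fin m) : pderiv j P ∈ weightBound W (k + W j) n := by
  rw [mem_weightBound] at *
  intro e he
  rw [mem_support_iff, coeff_pderiv] at he
  have := hP _ (mem_support_iff.2 (left_ne_zero_of_mul he))
  rw [map_add, Finsupp.weight_single, one_smul] at this
  omega

/-- The operator `g` has weight at most `k` and its symbol in weight `k` is `L`: right
multiplication by `g` is, on normally ordered operators, multiplication by `L` up to terms of
lower weight. -/
def HasSymbol (W : Fin m ⊕ Fin m → ℕ) (k : ℕ) (g : D m) (L : SymbolRing m) : Prop :=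
  L ∈ weightBound W 0 k ∧ ∀ n, ∀ P ∈ weightBound W k n, ∃ Q ∈ weightBound W 1 n,
    normalOrdering m P * g = normalOrdering m (L * P + Q)

namespace HasSymbol

variable {k l : ℕ} {g h : D m} {L M : SymbolRing m}

lemma zero (k : ℕ) : HasSymbol W k 0 0 :=
  ⟨zero_mem _, fun n P _ => ⟨0, zero_mem _, by simp⟩⟩

lemma add (hg : HasSymbol W k g L) (hh : HasSymbol W k h M) : HasSymbol W k (g + h) (L + M) := by
  refine ⟨add_mem hg.1 hh.1, fun n P hP => ?_⟩
  obtain ⟨Q, hQ, h₁⟩ := hg.2 n P hP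
  obtain ⟨Q', hQ', h₂⟩ := hh.2 n P hP
  refine ⟨Q + Q', add_mem hQ hQ', ?_⟩
  rw [mul_add, h₁, h₂, ← map_add]
  congr 1
  ring

lemma smul (r : ℂ) (hg : HasSymbol W k g L) : HasSymbol W k (r • g) (r • L) := by
  refine ⟨Submodule.smul_mem _ _ hg.1, fun n P hP => ?_⟩
  obtain ⟨Q, hQ, h₁⟩ := hg.2 n P hP
  refine ⟨r • Q, Submodule.smul_mem _ _ hQ, ?_⟩
  rw [mul_smul_comm, h₁, ← map_smul, smul_add, smul_mul_assoc]

lemma sum {ι : Type*} (s : Finset ι) {g : ι → D m} {L : ι → SymbolRing m}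
    (hg : ∀ i ∈ s, HasSymbol W k (g i) (L i)) :
    HasSymbol W k (∑ i ∈ s, g i) (∑ i ∈ s, L i) := by
  classical
  induction s using Finset.induction_on with
  | empty => simpa using zero k
  | insert i s hi ih =>
    rw [Finset.sum_insert hi, Finset.sum_insert hi]
    exact (hg i (Finset.mem_insert_self _ _)).add
      (ih fun j hj => hg j (Finset.mem_insert_of_mem hj))

lemma mul (hg : HasSymbol W k g L) (hh : HasSymbol W l h M) :
    HasSymbol W (k + l) (g * h) (L * M) := by
  refine ⟨mul_mem_weightBound hg.1 (weightBound_mono (by omega) hh.1), fun n P hP => ?_⟩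
  rw [mem_weightBound] at hP
  obtain ⟨Q, hQ, h₁⟩ := hg.2 (n - l) P fun e he => by
    have := hP e he
    simp only [Set.mem_ofPred_eq]
    omega
  rw [mem_weightBound] at hQ
  have hQ' : Q ∈ weightBound W (l + 1) n := fun e he => by
    have := hQ e he
    simp only [Set.mem_ofPred_eq]
    omega
  have hLP : L * P ∈ weightBound W l n := mul_mem_weightBound hg.1 hP
  obtain ⟨R, hR, h₂⟩ := hh.2 n _ (add_mem hLP (weightBound_mono (by omega) hQ'))
  refine ⟨M * Q + R, add_mem (mul_mem_weightBound hh.1 hQ') hR, ?_⟩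
  rw [← mul_assoc, h₁, h₂]
  congr 1
  ring

/-- An operator of weight at most `k` has symbol `0` in every weight exceeding `k`. -/
lemma of_lt (hg : HasSymbol W k g L) (hkl : k < l) : HasSymbol W l g 0 := by
  refine ⟨zero_mem _, fun n P hP => ?_⟩
  obtain ⟨Q, hQ, h₁⟩ := hg.2 n P (weightBound_mono (by omega) hP)
  refine ⟨L * P + Q, add_mem (mul_mem_weightBound hg.1 (weightBound_mono (by omega) hP)) hQ, ?_⟩
  rw [h₁, zero_mul, zero_add]

lemma algebraMap (r : ℂ) : HasSymbol W 0 (algebraMap ℂ (D m) r) (C r) := by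
  refine ⟨monomial_mem_weightBound _ (by simp), fun n P _ => ⟨0, zero_mem _, ?_⟩⟩
  rw [add_zero, C_mul', map_smul, Algebra.smul_def, Algebra.commutes]

lemma d (i : Fin m) : HasSymbol W (W (Sum.inr i)) (d i) (X (Sum.inr i)) :=
  ⟨X_mem_weightBound _, fun n P _ =>
    ⟨0, zero_mem _, by rw [normalOrdering_mul_d, add_zero]⟩⟩

lemma x (i : Fin m) (hW : 0 < W (Sum.inl i) + W (Sum.inr i)) :
    HasSymbol W (W (Sum.inl i)) (x i) (X (Sum.inl i)) :=
  ⟨X_mem_weightBound _, fun n P hP =>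
    ⟨_, weightBound_mono (by omega) (pderiv_mem_weightBound hP (Sum.inr i)),
      normalOrdering_mul_x P i⟩⟩

end HasSymbol

/-- If `p` has symbol `L ≠ 0`, homogeneous of order `k`, then `L` is its principal symbol. -/
lemma HasSymbol.isPrincipalSymbol {k : ℕ} {p : D m} {L : SymbolRing m}
    (hp : HasSymbol (orderWeight m) k p L) (hL : IsWeightedHomogeneous (orderWeight m) L k)
    (h0 : L ≠ 0) : IsPrincipalSymbol p L := by
  obtain ⟨Q, hQ, h⟩ := hp.2 k 1 (monomial_mem_weightBound _ (by simp))
  rw [mem_weightBound] at hQ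
  rw [normalOrdering_one, one_mul, mul_one] at h
  have hQk : ∀ e, Finsupp.weight (orderWeight m) e = k → coeff e Q = 0 := by
    intro e he
    by_contra hne
    have := hQ e (mem_support_iff.2 hne)
    omega
  have hdeg : weightedTotalDegree (orderWeight m) (L + Q) = k := by
    apply le_antisymm
    · refine Finset.sup_le fun e he => ?_
      classical
      rcases Finset.mem_union.1 (support_add he) with he | he
      · exact (hL (mem_support_iff.1 he)).le
      · have := hQ e he
        omega
    · obtain ⟨e, he⟩ := ne_zero_iff.1 h0
      have hw := hL he
      rw [← hw]
      apply le_weightedTotalDegree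
      rw [mem_support_iff, coeff_add, hQk e hw, add_zero]
      exact he
  refine ⟨L + Q, by rw [← normalOrdering_apply, h], ?_⟩
  rw [initialForm, hdeg]
  ext e
  rw [coeff_weightedHomogeneousComponent, coeff_add]
  split_ifs with he
  · rw [hQk e he, add_zero]
  · by_contra hne
    exact he (hL (Ne.symm hne))

/-! ### Left ideals with coprime leading monomials -/

/-- The map `(Pᵢ) ↦ ∑ᵢ pᵢ gᵢ`, where `pᵢ` is the operator with normally ordered form `Pᵢ`. -/
def normalCombination (g : Fin m → D m) : (Fin m → SymbolRing m) →ₗ[ℂ] D m :=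
  ∑ i, LinearMap.mulRight ℂ (g i) ∘ₗ normalOrdering m ∘ₗ LinearMap.proj i

lemma normalCombination_apply (g : Fin m → D m) (P : Fin m → SymbolRing m) :
    normalCombination g P = ∑ i, normalOrdering m (P i) * g i := by
  simp [normalCombination]

/-- The families `(Pᵢ)` such that no monomial of `Pᵢ` is divisible by an `e j` with `j < i`. -/
def standardFamilies (e : Fin m → Fin m ⊕ Fin m →₀ ℕ) : Submodule ℂ (Fin m → SymbolRing m) :=
  Submodule.pi Set.univ fun i => restrictSupport ℂ {u | ∀ j < i, ¬ e j ≤ u}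

lemma mem_standardFamilies {e : Fin m → Fin m ⊕ Fin m →₀ ℕ} {P : Fin m → SymbolRing m} :
    P ∈ standardFamilies e ↔ ∀ i, ∀ u ∈ (P i).support, ∀ j < i, ¬ e j ≤ u := by
  simp only [standardFamilies, Submodule.mem_pi, Set.mem_univ, true_implies]
  rfl

variable {g : Fin m → D m} {e : Fin m → Fin m ⊕ Fin m →₀ ℕ}

/-- Division: if the `gᵢ` have symbols the monomials `e i` and their commutators are combinations
of the `gᵢ` of lower weight than expected, then every multiple of a `gᵢ` has a standard
representation. A term `u gᵢ` violating the condition, with `u` divisible by `e j` for some `j < i`,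
is rewritten as `(u / e j) gⱼ gᵢ = (u / e j) gᵢ gⱼ` up to terms of lower weight. -/
lemma normalOrdering_mul_mem_standard
    (hsym : ∀ i, HasSymbol W (Finsupp.weight W (e i)) (g i) (monomial (e i) 1))
    (hcomm : ∀ i j, ∃ k q L r, g j * g i = g i * g j + q * g k ∧ HasSymbol W r q L ∧
      r + Finsupp.weight W (e k) < Finsupp.weight W (e i) + Finsupp.weight W (e j)) :
    ∀ (n : ℕ) (i : Fin m), ∀ P ∈ weightBound W (Finsupp.weight W (e i)) n,
      normalOrdering m P * g i ∈ (standardFamilies e).map (normalCombination g) := by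
  intro n
  induction n using Nat.strong_induction_on with
  | _ n ihn =>
  intro i
  induction i using WellFoundedLT.induction with
  | _ i ihi =>
  intro P hP
  have hlow : ∀ k, ∀ Q ∈ weightBound W (Finsupp.weight W (e k) + 1) n,
      normalOrdering m Q * g k ∈ (standardFamilies e).map (normalCombination g) := by
    intro k Q hQ
    rw [mem_weightBound] at hQ
    rcases Nat.eq_zero_or_pos n with h0 | h0
    · have : Q = 0 := by
        rw [← support_eq_empty]
        refine Finset.eq_empty_of_forall_notMem fun u hu => ?_
        have := hQ u hu
        omega
      rw [this, map_zero, zero_mul]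
      exact zero_mem _
    · refine ihn (n - 1) (by omega) k Q (mem_weightBound.2 fun u hu => ?_)
      have := hQ u hu
      omega
  rw [P.as_sum, map_sum, Finset.sum_mul]
  refine Submodule.sum_mem _ fun u hu => ?_
  have hun := mem_weightBound.1 hP u hu
  generalize P.coeff u = r
  by_cases hstd : ∀ j < i, ¬ e j ≤ u
  · refine ⟨Pi.single i (monomial u r), ?_, ?_⟩
    · rw [SetLike.mem_coe, mem_standardFamilies]
      intro k v hv
      by_cases hk : k = i
      · subst hk
        rw [Pi.single_eq_same] at hv
        rw [Finset.mem_singleton.1 (support_monomial_subset hv)]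
        exact hstd
      · simp [Pi.single_eq_of_ne hk] at hv
    · rw [normalCombination_apply, Finset.sum_eq_single i]
      · rw [Pi.single_eq_same]
      · intro k _ hk
        rw [Pi.single_eq_of_ne hk, map_zero, zero_mul]
      · simp
  · push Not at hstd
    obtain ⟨j, hji, hju⟩ := hstd
    obtain ⟨v, rfl⟩ := exists_add_of_le hju
    rw [map_add] at hun
    -- `N(v) gⱼ = N(e j + v) + N(Q)`, so `N(e j + v) gᵢ = N(v) gⱼ gᵢ - N(Q) gᵢ`.
    obtain ⟨Q, hQ, h₁⟩ := (hsym j).2 (Finsupp.weight W (e j) + Finsupp.weight W v) (monomial v r)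
      (monomial_mem_weightBound _ (by omega))
    rw [monomial_mul, one_mul] at h₁
    have hQi : normalOrdering m (-Q) * g i ∈ (standardFamilies e).map (normalCombination g) := by
      apply hlow
      apply neg_mem
      rw [mem_weightBound] at hQ ⊢
      intro w hw
      have := hQ w hw
      omega
    obtain ⟨k, q, L, s, hc, hq, hs⟩ := hcomm i j
    have hjj : normalOrdering m (monomial v r) * g j * g i ∈
        (standardFamilies e).map (normalCombination g) := by
      rw [mul_assoc, hc, mul_add, ← mul_assoc, ← mul_assoc]
      refine add_mem ?_ ?_
      · obtain ⟨R, hR, h₂⟩ := (hsym i).2 (Finsupp.weight W (e i) + Finsupp.weight W v)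
          (monomial v r) (monomial_mem_weightBound _ (by omega))
        rw [h₂, monomial_mul]
        apply ihi j hji
        refine add_mem (monomial_mem_weightBound _ (by rw [map_add]; omega)) ?_
        rw [mem_weightBound] at hR ⊢
        intro w hw
        have := hR w hw
        omega
      · obtain ⟨R, hR, h₂⟩ := hq.2 (s + Finsupp.weight W v) (monomial v r)
          (monomial_mem_weightBound _ (by omega))
        rw [h₂]
        apply hlow
        refine add_mem ?_ ?_
        · have : monomial v r ∈ weightBound W (s + (Finsupp.weight W (e k) + 1)) n :=
            monomial_mem_weightBound _ (by omega)
          exact mul_mem_weightBound hq.1 this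
        · rw [mem_weightBound] at hR ⊢
          intro w hw
          have := hR w hw
          omega
    rw [h₁] at hjj
    have h₃ : monomial (e j + v) r = monomial (e j + v) r + Q + -Q := by ring
    rw [h₃, map_add, add_mul]
    exact add_mem hjj hQi

lemma exists_standard_of_mem_span
    (hsym : ∀ i, HasSymbol W (Finsupp.weight W (e i)) (g i) (monomial (e i) 1))
    (hcomm : ∀ i j, ∃ k q L r, g j * g i = g i * g j + q * g k ∧ HasSymbol W r q L ∧
      r + Finsupp.weight W (e k) < Finsupp.weight W (e i) + Finsupp.weight W (e j))
    {p : D m} (hp : p ∈ Ideal.span (Set.range g)) :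
    ∃ P ∈ standardFamilies e, ∑ i, normalOrdering m (P i) * g i = p := by
  obtain ⟨q, rfl⟩ := (Submodule.mem_span_range_iff_exists_fun _).1 hp
  have : ∑ i, q i • g i ∈ (standardFamilies e).map (normalCombination g) := by
    refine Submodule.sum_mem _ fun i _ => ?_
    obtain ⟨P, hP⟩ := normalOrdering_surjective (q i)
    rw [← hP, smul_eq_mul]
    refine normalOrdering_mul_mem_standard hsym hcomm
      (P.support.sup (Finsupp.weight W) + Finsupp.weight W (e i)) i P fun u hu => ?_
    exact Nat.add_le_add_right (Finset.le_sup (f := Finsupp.weight W) hu) _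
  obtain ⟨P, hP, h⟩ := this
  exact ⟨P, hP, by rw [← normalCombination_apply, h]⟩

/-- In a standard representation the leading terms cannot cancel, because the products of the
coprime monomials `e i` with monomials allowed in `Pᵢ` are distinct for distinct `i`. -/
lemma weightBound_of_standard
    (hsym : ∀ i, HasSymbol W (Finsupp.weight W (e i)) (g i) (monomial (e i) 1))
    (hcop : ∀ i j, i ≠ j → ∀ k, e i k = 0 ∨ e j k = 0)
    {P : Fin m → SymbolRing m} (hP : P ∈ standardFamilies e) {R : SymbolRing m} {n : ℕ}
    (hR : R ∈ weightBound W 0 n)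
    (h : ∑ i, normalOrdering m (P i) * g i = normalOrdering m R) (i : Fin m) :
    P i ∈ weightBound W (Finsupp.weight W (e i)) n := by
  rw [mem_standardFamilies] at hP
  have key : ∀ l, (∀ i, P i ∈ weightBound W (Finsupp.weight W (e i)) (n + l)) →
      ∀ i, P i ∈ weightBound W (Finsupp.weight W (e i)) n := by
    intro l
    induction l with
    | zero => exact id
    | succ l ih =>
      intro hl
      refine ih fun i => mem_weightBound.2 fun u hu => ?_
      have hle := mem_weightBound.1 (hl i) u hu
      by_contra hlt
      have hu' : Finsupp.weight W u + Finsupp.weight W (e i) = n + l + 1 := by omega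
      choose Q hQ hPQ using fun j => (hsym j).2 (n + l + 1) (P j) (hl j)
      have hRsum : R = ∑ j, (monomial (e j) 1 * P j + Q j) := by
        apply normalOrdering_injective
        rw [← h, map_sum]
        exact Finset.sum_congr rfl fun j _ => hPQ j
      have hc : coeff (e i + u) R = 0 := by
        by_contra hne
        have := mem_weightBound.1 hR _ (mem_support_iff.2 hne)
        rw [map_add] at this
        omega
      rw [hRsum, coeff_sum, Finset.sum_eq_single i] at hc
      · rw [coeff_add, coeff_monomial_mul, one_mul] at hc
        have hQi : coeff (e i + u) (Q i) = 0 := by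
          by_contra hne
          have := mem_weightBound.1 (hQ i) _ (mem_support_iff.2 hne)
          rw [map_add] at this
          omega
        rw [hQi, add_zero] at hc
        exact mem_support_iff.1 hu hc
      · intro j _ hji
        have hQj : coeff (e i + u) (Q j) = 0 := by
          by_contra hne
          have := mem_weightBound.1 (hQ j) _ (mem_support_iff.2 hne)
          rw [map_add] at this
          omega
        rw [coeff_add, hQj, add_zero, coeff_monomial_mul']
        split_ifs with hjle
        · rw [one_mul]
          by_contra hne
          have hju : e j ≤ u := by
            intro k
            have := hjle k
            rw [Finsupp.add_apply] at this
            rcases hcop i j (Ne.symm hji) k with h0 | h0 <;> omega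
          rcases lt_or_gt_of_ne hji with hlt' | hgt
          · exact hP i u hu j hlt' hju
          · refine hP j _ (mem_support_iff.2 hne) i hgt fun k => ?_
            have := hju k
            rw [Finsupp.tsub_apply, Finsupp.add_apply]
            omega
        · rfl
      · simp
  refine key (Finset.univ.sup fun i => (P i).support.sup (Finsupp.weight W) +
    Finsupp.weight W (e i)) (fun i => mem_weightBound.2 fun u hu => ?_) i
  have h₁ : Finsupp.weight W u ≤ (P i).support.sup (Finsupp.weight W) := Finset.le_sup hu
  have h₂ := Finset.le_sup (f := fun i => (P i).support.sup (Finsupp.weight W) +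
    Finsupp.weight W (e i)) (Finset.mem_univ i)
  omega

/-! ### The operators `Aᵢ = ∂ᵢ (θᵢ + cᵢ - 1)` and `B = (θ + a) (θ + b)` -/

/-- The operator `Aᵢ = ∂ᵢ (θᵢ + cᵢ - 1) = xᵢ⁻¹ θᵢ (θᵢ + cᵢ - 1)`. -/
def besselOperator (c : Fin m → ℂ) (i : Fin m) : D m :=
  d i * (theta i + algebraMap ℂ (D m) (c i - 1))

/-- The operator `B = (θ + a) (θ + b)`. -/
def eulerProduct (m : ℕ) (a b : ℂ) : D m :=
  (thetaSum m + algebraMap ℂ (D m) a) * (thetaSum m + algebraMap ℂ (D m) b)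

/-- Differences in `D m` are rewritten as linear combinations, so that later computations only use
the semiring and `ℂ`-algebra structures of `D m`, which are inherited directly from `Subalgebra`. -/
lemma sub_eq_add_neg_one_smul (p q : D m) : p - q = p + (-1 : ℂ) • q := by
  apply Subtype.ext
  refine LinearMap.ext fun f => ?_
  simp [sub_eq_add_neg]

lemma lauricellaOperator_eq (a b : ℂ) (c : Fin m → ℂ) (i : Fin m) :
    lauricellaOperator a b c i =
      x i * (besselOperator c i + (-1 : ℂ) • eulerProduct m a b) := by
  have h : theta i + algebraMap ℂ (D m) (c i) + (-1 : ℂ) • (1 : D m) =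
      theta i + algebraMap ℂ (D m) (c i - 1) := by
    rw [sub_eq_add_neg, map_add, add_assoc, Algebra.algebraMap_eq_smul_one (-1 : ℂ)]
  rw [lauricellaOperator, sub_eq_add_neg_one_smul, sub_eq_add_neg_one_smul _ (1 : D m), h,
    mul_add (x i) (besselOperator c i), mul_smul_comm, besselOperator, eulerProduct, theta]
  simp only [mul_assoc]

lemma thetaSum_mul_d (i : Fin m) : thetaSum m * d i + d i = d i * thetaSum m := by
  have h : ∀ j, d i * theta j = theta j * d i + if j = i then d i else 0 := by
    intro j
    rw [theta, ← mul_assoc, d_mul_x, add_mul, mul_assoc, (commute_d i j).eq, ← mul_assoc]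
    congr 1
    by_cases hj : j = i
    · simp [hj]
    · simp [hj, Ne.symm hj]
  rw [thetaSum, Finset.sum_mul, Finset.mul_sum, Finset.sum_congr rfl fun j _ => h j,
    Finset.sum_add_distrib]
  simp

lemma thetaSum_mul_x (i : Fin m) : thetaSum m * x i = x i * thetaSum m + x i := by
  have h : ∀ j, theta j * x i = x i * theta j + if j = i then x i else 0 := by
    intro j
    rw [theta, mul_assoc, d_mul_x, mul_add, ← mul_assoc, (commute_x j i).eq, mul_assoc]
    congr 1
    by_cases hj : j = i
    · simp [hj]
    · simp [hj]
  rw [thetaSum, Finset.sum_mul, Finset.mul_sum, Finset.sum_congr rfl fun j _ => h j,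
    Finset.sum_add_distrib]
  simp

lemma commute_thetaSum_theta (i : Fin m) : Commute (thetaSum m) (theta i) := by
  change thetaSum m * (x i * d i) = x i * d i * thetaSum m
  rw [← mul_assoc, thetaSum_mul_x, add_mul, mul_assoc, mul_assoc, ← thetaSum_mul_d, mul_add]

lemma commute_besselOperator (c : Fin m → ℂ) (i j : Fin m) :
    Commute (besselOperator c i) (besselOperator c j) := by
  rcases eq_or_ne i j with rfl | hij
  · exact Commute.refl _
  have hdx : ∀ k l : Fin m, k ≠ l → Commute (d k) (x l) := by
    intro k l hkl
    have := d_mul_x k l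
    rwa [if_neg hkl, add_zero] at this
  have hdt : ∀ k l : Fin m, k ≠ l → Commute (d k) (theta l) := fun k l hkl =>
    (hdx k l hkl).mul_right (commute_d k l)
  have htt : Commute (theta i) (theta j) :=
    ((commute_x i j).mul_left (hdx i j hij)).mul_right
      ((hdt j i hij.symm).symm)
  have hA : ∀ (p : D m) (r : ℂ), Commute p (algebraMap ℂ (D m) r) := fun p r =>
    (Algebra.commutes r p).symm
  refine Commute.mul_left (Commute.mul_right (commute_d i j) ?_) (Commute.mul_right ?_ ?_)
  · exact (hdt i j hij).add_right (hA _ _)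
  · exact ((hdt j i hij.symm).symm).add_left (hA _ _).symm
  · exact (htt.add_right (hA _ _)).add_left (hA _ _).symm

/-- The operator `q = 2θ + a + b + 1 = (θ + a + 1) (θ + b + 1) - (θ + a) (θ + b)`. -/
def eulerDifference (m : ℕ) (a b : ℂ) : D m :=
  thetaSum m + thetaSum m + algebraMap ℂ (D m) (a + b + 1)

/-- As `Aᵢ` is homogeneous of degree `-1`, it satisfies `Aᵢ p(θ) = p(θ + 1) Aᵢ`. -/
lemma besselOperator_mul_eulerProduct (a b : ℂ) (c : Fin m → ℂ) (i : Fin m) :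
    besselOperator c i * eulerProduct m a b =
      eulerProduct m a b * besselOperator c i + eulerDifference m a b * besselOperator c i := by
  have hE : Commute (thetaSum m) (theta i + algebraMap ℂ (D m) (c i - 1)) :=
    (commute_thetaSum_theta i).add_right (Algebra.commutes _ _).symm
  have h₁ : besselOperator c i * thetaSum m =
      thetaSum m * besselOperator c i + besselOperator c i := by
    rw [besselOperator, mul_assoc, ← hE.eq, ← mul_assoc, ← thetaSum_mul_d, add_mul, mul_assoc]
  have h₂ : ∀ r : ℂ, besselOperator c i * (thetaSum m + algebraMap ℂ (D m) r) =
      (thetaSum m + algebraMap ℂ (D m) r + 1) * besselOperator c i := by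
    intro r
    rw [mul_add, h₁, ← Algebra.commutes, add_mul, add_mul, one_mul]
    abel
  rw [eulerProduct, ← mul_assoc, h₂, mul_assoc, h₂, ← mul_assoc, ← add_mul]
  congr 1
  rw [eulerDifference, map_add, map_add, map_one]
  simp only [add_mul, mul_add, one_mul, mul_one]
  abel

/-! ### A Gröbner basis of the left ideal generated by the `Aᵢ - B` -/

/-- The generators `Aᵢ - A_o` for `i ≠ o`, and `B - A_o` for `i = o`, of the left ideal generated
by the `Aᵢ - B`. -/
def generator (a b : ℂ) (c : Fin m → ℂ) (o i : Fin m) : D m :=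
  (if i = o then eulerProduct m a b else besselOperator c i) + (-1 : ℂ) • besselOperator c o

lemma lauricellaIdeal_le (a b : ℂ) (c : Fin m → ℂ) (o : Fin m) :
    lauricellaIdeal a b c ≤ Ideal.span (Set.range (generator a b c o)) := by
  rw [lauricellaIdeal, Ideal.span_le]
  rintro _ ⟨i, rfl⟩
  have hmem : ∀ i, generator a b c o i ∈ Ideal.span (Set.range (generator a b c o)) := fun i =>
    Ideal.subset_span ⟨i, rfl⟩
  have hsmul : (-1 : ℂ) • generator a b c o o ∈ Ideal.span (Set.range (generator a b c o)) := by
    rw [Algebra.smul_def]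
    exact Ideal.mul_mem_left _ _ (hmem o)
  rw [SetLike.mem_coe, lauricellaOperator_eq]
  apply Ideal.mul_mem_left
  by_cases hi : i = o
  · subst hi
    convert hsmul using 1
    rw [generator, if_pos rfl]
    module
  · convert add_mem (hmem i) hsmul using 1
    rw [generator, generator, if_neg hi, if_pos rfl]
    module

/-- The commutators of the generators: `[gᵢ, g_o] = (2θ + a + b + 1) gᵢ`, and all others vanish. -/
lemma generator_mul_generator (a b : ℂ) (c : Fin m → ℂ) (o i j : Fin m) :
    ∃ (k : Fin m) (r : ℂ), generator a b c o j * generator a b c o i =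
        generator a b c o i * generator a b c o j +
          (r • eulerDifference m a b) * generator a b c o k ∧
      (i = o ∧ k = j ∨ j = o ∧ k = i ∨ r = 0 ∧ k = i) := by
  have hAA := fun i j => (commute_besselOperator c i j).eq
  have hAB := besselOperator_mul_eulerProduct a b c
  by_cases hi : i = o <;> by_cases hj : j = o
  · subst hi hj
    exact ⟨_, 0, by simp, Or.inr (Or.inr ⟨rfl, rfl⟩)⟩
  · refine ⟨j, 1, ?_, Or.inl ⟨hi, rfl⟩⟩
    subst hi
    simp only [generator, if_neg hj, if_true, add_mul, mul_add, smul_mul_assoc, mul_smul_comm,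
      hAB, hAA i j]
    module
  · refine ⟨i, -1, ?_, Or.inr (Or.inl ⟨hj, rfl⟩)⟩
    subst hj
    simp only [generator, if_neg hi, if_true, add_mul, mul_add, smul_mul_assoc, mul_smul_comm,
      hAB, hAA i j]
    module
  · refine ⟨i, 0, ?_, Or.inr (Or.inr ⟨rfl, rfl⟩)⟩
    simp only [generator, if_neg hi, if_neg hj, add_mul, mul_add, smul_mul_assoc, mul_smul_comm,
      hAA i j, hAA i o, hAA j o, zero_smul, zero_mul]
    module

/-! ### Symbols of the generators -/

lemma hasSymbol_theta (i : Fin m) (hW : 0 < W (Sum.inl i) + W (Sum.inr i)) :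
    HasSymbol W (W (Sum.inl i) + W (Sum.inr i)) (theta i) (X (Sum.inl i) * X (Sum.inr i)) :=
  (HasSymbol.x i hW).mul (HasSymbol.d i)

lemma hasSymbol_besselOperator (c : Fin m → ℂ) (i : Fin m)
    (hW : 0 < W (Sum.inl i) + W (Sum.inr i)) :
    HasSymbol W (W (Sum.inr i) + (W (Sum.inl i) + W (Sum.inr i))) (besselOperator c i)
      (X (Sum.inr i) * (X (Sum.inl i) * X (Sum.inr i))) := by
  have h := (HasSymbol.d i).mul ((hasSymbol_theta i hW).add
    ((HasSymbol.algebraMap (c i - 1)).of_lt hW))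
  rwa [add_zero] at h

lemma hasSymbol_eulerProduct {k : ℕ} (hk : 0 < k) {s : SymbolRing m}
    (h : HasSymbol W k (thetaSum m) s) (a b : ℂ) :
    HasSymbol W (k + k) (eulerProduct m a b) (s * s) := by
  have h' := fun r => h.add ((HasSymbol.algebraMap r).of_lt hk)
  simp only [add_zero] at h'
  exact (h' a).mul (h' b)

lemma hasSymbol_eulerDifference {k : ℕ} (hk : 0 < k) {s : SymbolRing m}
    (h : HasSymbol W k (thetaSum m) s) (a b : ℂ) :
    HasSymbol W k (eulerDifference m a b) (s + s) := by
  have h' := (h.add h).add ((HasSymbol.algebraMap (a + b + 1)).of_lt hk)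
  rwa [add_zero] at h'

/-- The polynomial `s = ∑ⱼ xⱼ ξⱼ`. -/
def eulerSymbol (m : ℕ) : SymbolRing m := ∑ j, X (Sum.inl j) * X (Sum.inr j)

/-- The symbol of order two of the generator `gᵢ`. -/
def generatorSymbol (o i : Fin m) : SymbolRing m :=
  (if i = o then eulerSymbol m * eulerSymbol m
    else X (Sum.inr i) * (X (Sum.inl i) * X (Sum.inr i))) +
  (-1 : ℂ) • (X (Sum.inr o) * (X (Sum.inl o) * X (Sum.inr o)))

lemma hasSymbol_order_thetaSum : HasSymbol (orderWeight m) 1 (thetaSum m) (eulerSymbol m) :=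
  HasSymbol.sum _ fun i _ => hasSymbol_theta i Nat.zero_lt_one

lemma hasSymbol_order_generator (a b : ℂ) (c : Fin m → ℂ) (o i : Fin m) :
    HasSymbol (orderWeight m) 2 (generator a b c o i) (generatorSymbol o i) := by
  have hA : ∀ i, HasSymbol (orderWeight m) 2 (besselOperator c i)
      (X (Sum.inr i) * (X (Sum.inl i) * X (Sum.inr i))) := fun i =>
    hasSymbol_besselOperator c i Nat.zero_lt_one
  rw [generator, generatorSymbol]
  refine HasSymbol.add ?_ ((hA o).smul _)
  split_ifs
  · exact hasSymbol_eulerProduct Nat.zero_lt_one hasSymbol_order_thetaSum a b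
  · exact hA i

lemma isPrincipalSymbol_lauricellaOperator (a b : ℂ) (c : Fin m → ℂ) (i : Fin m) :
    IsPrincipalSymbol (lauricellaOperator a b c i)
      (X (Sum.inl i) * (X (Sum.inr i) * (X (Sum.inl i) * X (Sum.inr i)) +
        (-1 : ℂ) • (eulerSymbol m * eulerSymbol m))) := by
  have hs : HasSymbol (orderWeight m) (0 + 2) (lauricellaOperator a b c i)
      (X (Sum.inl i) * (X (Sum.inr i) * (X (Sum.inl i) * X (Sum.inr i)) +
        (-1 : ℂ) • (eulerSymbol m * eulerSymbol m))) := by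
    rw [lauricellaOperator_eq]
    exact (HasSymbol.x i Nat.zero_lt_one).mul
      (HasSymbol.add (hasSymbol_besselOperator c i Nat.zero_lt_one)
        ((hasSymbol_eulerProduct Nat.zero_lt_one hasSymbol_order_thetaSum a b).smul _))
  refine hs.isPrincipalSymbol ?_ ?_
  · have hx : ∀ j, IsWeightedHomogeneous (orderWeight m) (X (Sum.inl j) : SymbolRing m) 0 :=
      fun j => isWeightedHomogeneous_X ℂ (orderWeight m) (Sum.inl j)
    have hξ : ∀ j, IsWeightedHomogeneous (orderWeight m) (X (Sum.inr j) : SymbolRing m) 1 :=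
      fun j => isWeightedHomogeneous_X ℂ (orderWeight m) (Sum.inr j)
    have he : IsWeightedHomogeneous (orderWeight m) (eulerSymbol m) 1 :=
      IsWeightedHomogeneous.sum _ _ _ fun j _ => (hx j).mul (hξ j)
    have h₁ := (hξ i).mul ((hx i).mul (hξ i))
    have h₂ := (he.mul he).C_mul (-1)
    rw [C_mul'] at h₂
    exact (hx i).mul (h₁.add h₂)
  · intro h0
    -- The symbol takes the value `2 * (2 - 2 ^ 2)` at the point with `xᵢ = 2`, `ξᵢ = 1` and all
    -- other coordinates zero.
    have h := congrArg (eval (Sum.elim (Pi.single i 2) (Pi.single i 1 : Fin m → ℂ))) h0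
    simp [eulerSymbol, Pi.single_apply] at h
    norm_num at h

/-! ### A weight with coprime leading monomials -/

/-- The exponents of `xᵢ ξᵢ²` for `i ≠ o`, and of `x_o² ξ_o²` for `i = o`. -/
def leadingExponent (o i : Fin m) : Fin m ⊕ Fin m →₀ ℕ :=
  Finsupp.single (Sum.inl i) (if i = o then 2 else 1) + Finsupp.single (Sum.inr i) 2

/-- A weight in which the leading term of the symbol of `gᵢ` is the monomial with exponent
`leadingExponent o i`, for every `K`; for large `K` it refines the order of an operator. -/
def refinedWeight (K : ℕ) (o : Fin m) : Fin m ⊕ Fin m → ℕ :=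
  Sum.elim (fun i => if i = o then 4 else 0) fun i => (if i = o then 1 else 4) + K

lemma leadingExponent_coprime (o : Fin m) {i j : Fin m} (hij : i ≠ j) (k : Fin m ⊕ Fin m) :
    leadingExponent o i k = 0 ∨ leadingExponent o j k = 0 := by
  rcases k with k | k
  all_goals
    by_cases hi : i = k
    · exact Or.inr (by simp [leadingExponent, hi ▸ hij.symm])
    · exact Or.inl (by simp [leadingExponent, hi])

lemma weight_leadingExponent (K : ℕ) (o i : Fin m) :
    Finsupp.weight (refinedWeight K o) (leadingExponent o i) =
      if i = o then 10 + 2 * K else 8 + 2 * K := by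
  rw [leadingExponent, map_add, Finsupp.weight_single, Finsupp.weight_single]
  by_cases hi : i = o
  · simp [refinedWeight, hi]
    ring
  · simp [refinedWeight, hi]
    ring

lemma weight_refinedWeight (K : ℕ) (o : Fin m) (e : Fin m ⊕ Fin m →₀ ℕ) :
    Finsupp.weight (refinedWeight K o) e =
      Finsupp.weight (refinedWeight 0 o) e + K * Finsupp.weight (orderWeight m) e := by
  rw [Finsupp.weight_apply, Finsupp.weight_apply, Finsupp.weight_apply, Finsupp.sum, Finsupp.sum,
    Finsupp.sum, Finset.mul_sum, ← Finset.sum_add_distrib]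
  refine Finset.sum_congr rfl fun k _ => ?_
  rcases k with k | k
  · simp [refinedWeight, orderWeight]
  · simp only [refinedWeight, orderWeight, Sum.elim_inr, smul_eq_mul]
    ring

lemma refinedWeight_pos (K : ℕ) (o i : Fin m) :
    0 < refinedWeight K o (Sum.inl i) + refinedWeight K o (Sum.inr i) := by
  by_cases hi : i = o
  · simp [refinedWeight, hi]
  · simp [refinedWeight, hi]

lemma hasSymbol_refined_thetaSum (K : ℕ) (o : Fin m) :
    HasSymbol (refinedWeight K o) (5 + K) (thetaSum m) (X (Sum.inl o) * X (Sum.inr o)) := by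
  have h : ∀ i ∈ Finset.univ, HasSymbol (refinedWeight K o) (5 + K) (theta i)
      (if i = o then X (Sum.inl o) * X (Sum.inr o) else 0) := by
    intro i _
    have ht := hasSymbol_theta i (refinedWeight_pos K o i)
    split_ifs with hi
    · subst hi
      convert ht using 1
      simp [refinedWeight]
      ring
    · apply ht.of_lt
      simp [refinedWeight, hi]
  simpa [thetaSum] using HasSymbol.sum Finset.univ h

lemma hasSymbol_refined_generator (K : ℕ) (a b : ℂ) (c : Fin m → ℂ) (o i : Fin m) :
    HasSymbol (refinedWeight K o) (Finsupp.weight (refinedWeight K o) (leadingExponent o i))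
      (generator a b c o i) (monomial (leadingExponent o i) 1) := by
  have hA := fun i => hasSymbol_besselOperator c i (refinedWeight_pos K o i)
  have hlow : HasSymbol (refinedWeight K o)
      (Finsupp.weight (refinedWeight K o) (leadingExponent o i)) (besselOperator c o) 0 := by
    apply (hA o).of_lt
    rw [weight_leadingExponent]
    simp [refinedWeight]
    split_ifs <;> omega
  have hlead : HasSymbol (refinedWeight K o)
      (Finsupp.weight (refinedWeight K o) (leadingExponent o i))
      (if i = o then eulerProduct m a b else besselOperator c i)
      (monomial (leadingExponent o i) 1) := by
    rw [weight_leadingExponent]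
    split_ifs with hi
    · convert hasSymbol_eulerProduct (by omega) (hasSymbol_refined_thetaSum K o) a b using 1
      · ring
      · rw [leadingExponent, monomial_single_add, if_pos hi, ← X_pow_eq_monomial, hi]
        ring
    · convert hA i using 1
      · simp [refinedWeight, hi]
        ring
      · rw [leadingExponent, monomial_single_add, if_neg hi, ← X_pow_eq_monomial]
        ring
  have h := hlead.add (hlow.smul (-1))
  rwa [smul_zero, add_zero] at h

lemma generator_commutator (K : ℕ) (a b : ℂ) (c : Fin m → ℂ) (o i j : Fin m) :
    ∃ k q L r, generator a b c o j * generator a b c o i =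
        generator a b c o i * generator a b c o j + q * generator a b c o k ∧
      HasSymbol (refinedWeight K o) r q L ∧
      r + Finsupp.weight (refinedWeight K o) (leadingExponent o k) <
        Finsupp.weight (refinedWeight K o) (leadingExponent o i) +
          Finsupp.weight (refinedWeight K o) (leadingExponent o j) := by
  obtain ⟨k, r, h, hk⟩ := generator_mul_generator a b c o i j
  have hq := (hasSymbol_eulerDifference (by omega) (hasSymbol_refined_thetaSum K o) a b).smul r
  have ho := weight_leadingExponent K o o
  rw [if_pos rfl] at ho
  rcases hk with ⟨rfl, rfl⟩ | ⟨rfl, rfl⟩ | ⟨rfl, rfl⟩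
  · exact ⟨_, _, _, _, h, hq, by omega⟩
  · exact ⟨_, _, _, _, h, hq, by omega⟩
  · rw [zero_smul] at h
    refine ⟨_, _, _, _, h, HasSymbol.zero 0, ?_⟩
    have := weight_leadingExponent K o j
    split_ifs at this <;> omega

/-! ### The characteristic variety along a line through the zero section -/

/-- Restriction of a polynomial to the line `T ↦ (z, T ξ)`. -/
def lineEval (z ξ : Fin m → ℂ) : SymbolRing m →ₐ[ℂ] Polynomial ℂ :=
  aeval (Sum.elim (fun i => Polynomial.C (z i)) fun i => Polynomial.C (ξ i) * Polynomial.X)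

lemma coeff_lineEval (z ξ : Fin m → ℂ) (n : ℕ) (P : SymbolRing m) :
    (lineEval z ξ P).coeff n =
      eval (Sum.elim z ξ) (weightedHomogeneousComponent (orderWeight m) n P) := by
  induction P using MvPolynomial.induction_on' with
  | monomial e r =>
    have h₁ : lineEval z ξ (monomial e r) =
        Polynomial.C (eval (Sum.elim z ξ) (monomial e r)) *
          Polynomial.X ^ Finsupp.weight (orderWeight m) e := by
      rw [lineEval, aeval_monomial, eval_monomial, Finsupp.weight_apply, Finsupp.prod, Finsupp.prod,
        Finsupp.sum, ← Finset.prod_pow_eq_pow_sum, map_mul, map_prod, mul_assoc,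
        ← Finset.prod_mul_distrib]
      congr 1
      refine Finset.prod_congr rfl fun k _ => ?_
      rcases k with k | k
      · simp [orderWeight]
      · simp [orderWeight, mul_pow]
    have h₂ : weightedHomogeneousComponent (orderWeight m) n (monomial e r) =
        if n = Finsupp.weight (orderWeight m) e then monomial e r else 0 :=
      weightedHomogeneousComponent_of_mem (isWeightedHomogeneous_monomial _ _ _ rfl)
    rw [h₁, h₂, Polynomial.coeff_C_mul_X_pow]
    split_ifs <;> simp
  | add P Q hP hQ => rw [map_add, Polynomial.coeff_add, hP, hQ, map_add, map_add]

lemma coeff_lineEval_of_mem_weightBound (z ξ : Fin m → ℂ) {n : ℕ} {P : SymbolRing m}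
    (hP : P ∈ weightBound (orderWeight m) 1 n) : (lineEval z ξ P).coeff n = 0 := by
  rw [coeff_lineEval, weightedHomogeneousComponent_eq_zero', map_zero]
  intro e he
  have := mem_weightBound.1 hP e he
  omega

/-- If the symbols of the generators vanish on the line through `(z, ξ)`, so do the principal
symbols of all elements of the Lauricella ideal: for `K` larger than all weights occurring in a
given element, a representation without cancellation in the refined weight has none in the order
either. -/
lemma mem_characteristicVariety (a b : ℂ) (c : Fin m → ℂ) (o : Fin m) {z ξ : Fin m → ℂ}
    (h : ∀ i, lineEval z ξ (generatorSymbol o i) = 0) :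
    (z, ξ) ∈ characteristicVariety (lauricellaIdeal a b c) := by
  suffices hle : characteristicIdeal (lauricellaIdeal a b c) ≤
      RingHom.ker (eval (Sum.elim z ξ)) from fun f hf => hle hf
  rw [characteristicIdeal, Ideal.span_le]
  rintro _ ⟨p, hp, R, rfl, rfl⟩
  rw [SetLike.mem_coe, RingHom.mem_ker, initialForm, ← coeff_lineEval]
  set n := weightedTotalDegree (orderWeight m) R with hn
  set N := R.support.sup (Finsupp.weight (refinedWeight 0 o)) with hN
  obtain ⟨P, hP, hsum⟩ := exists_standard_of_mem_span
    (hasSymbol_refined_generator (N + 1) a b c o) (generator_commutator (N + 1) a b c o)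
    (lauricellaIdeal_le a b c o hp)
  rw [← normalOrdering_apply] at hsum
  have hR : R ∈ weightBound (refinedWeight (N + 1) o) 0 (N + (N + 1) * n) := by
    rw [mem_weightBound]
    intro e he
    rw [weight_refinedWeight, add_zero]
    exact add_le_add (Finset.le_sup (f := Finsupp.weight (refinedWeight 0 o)) he)
      (Nat.mul_le_mul_left _ (le_weightedTotalDegree _ he))
  have hPn : ∀ i, P i ∈ weightBound (orderWeight m) 2 n := by
    intro i
    have hb := weightBound_of_standard (hasSymbol_refined_generator (N + 1) a b c o)
      (fun _ _ hij => leadingExponent_coprime o hij) hP hR hsum i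
    rw [mem_weightBound] at hb ⊢
    intro e he
    have h₁ := hb e he
    rw [weight_refinedWeight] at h₁
    have h₂ := weight_leadingExponent (N + 1) o i
    have h₃ : (N + 1) * (Finsupp.weight (orderWeight m) e + 2) < (N + 1) * (n + 1) := by
      split_ifs at h₂ <;> nlinarith
    have := lt_of_mul_lt_mul_left h₃ (Nat.zero_le _)
    omega
  choose Q hQ hPQ using fun i => (hasSymbol_order_generator a b c o i).2 n (P i) (hPn i)
  have hRsum : R = ∑ i, (generatorSymbol o i * P i + Q i) := by
    apply normalOrdering_injective
    rw [← hsum, map_sum]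
    exact Finset.sum_congr rfl fun i _ => hPQ i
  have hline : lineEval z ξ R = lineEval z ξ (∑ i, Q i) := by
    rw [hRsum, map_sum, map_sum]
    refine Finset.sum_congr rfl fun i _ => ?_
    rw [map_add, map_mul, h, zero_mul, zero_add]
  rw [hline]
  exact coeff_lineEval_of_mem_weightBound z ξ (Submodule.sum_mem _ fun i _ => hQ i)

/-! ### The singular locus in the torus -/

lemma exists_sign_of_mem_singularLocus {a b : ℂ} {c : Fin m → ℂ} {z r : Fin m → ℂ}
    (hr : ∀ i, r i ^ 2 = z i) (hz : ∀ i, z i ≠ 0)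
    (h : z ∈ singularLocus (lauricellaIdeal a b c)) :
    ∃ ε : Fin m → ℤˣ, 1 + ∑ j, ((ε j : ℤ) : ℂ) * r j = 0 := by
  obtain ⟨⟨z, ξ⟩, ⟨hch, hξ⟩, rfl⟩ := h
  simp only [Set.mem_ofPred_eq] at hξ hz hr
  obtain ⟨s, hs⟩ : ∃ s, s = ∑ j, z j * ξ j := ⟨_, rfl⟩
  have heq : ∀ i, z i * ξ i ^ 2 = s ^ 2 := by
    intro i
    have h₁ := hch _ (Ideal.subset_span
      ⟨_, Ideal.subset_span ⟨i, rfl⟩, isPrincipalSymbol_lauricellaOperator a b c i⟩)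
    have h₂ : eval (Sum.elim z ξ) (eulerSymbol m) = s := by simp [eulerSymbol, hs]
    simp only [map_mul, map_add, eval_X, Sum.elim_inl, Sum.elim_inr, smul_eval, h₂] at h₁
    have h₃ := (mul_eq_zero.1 h₁).resolve_left (hz i)
    linear_combination h₃
  have hs0 : s ≠ 0 := by
    intro h0
    apply hξ
    funext i
    have := heq i
    rw [h0] at this
    simpa [hz i] using this
  have hε : ∀ i, ∃ u : ℤˣ, r i * ξ i = -((u : ℤ) : ℂ) * s := by
    intro i
    have : (r i * ξ i) ^ 2 = s ^ 2 := by rw [mul_pow, hr, heq]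
    rcases sq_eq_sq_iff_eq_or_eq_neg.1 this with h | h
    · exact ⟨-1, by simp [h]⟩
    · exact ⟨1, by simp [h]⟩
  choose ε hε using hε
  refine ⟨ε, ?_⟩
  have hsum : s = -(∑ j, ((ε j : ℤ) : ℂ) * r j) * s := by
    conv_lhs => rw [hs]
    rw [← Finset.sum_neg_distrib, Finset.sum_mul]
    refine Finset.sum_congr rfl fun j _ => ?_
    rw [← hr j]
    linear_combination r j * hε j
  have : (1 + ∑ j, ((ε j : ℤ) : ℂ) * r j) * s = 0 := by linear_combination hsum
  exact (mul_eq_zero.1 this).resolve_right hs0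

/-- The covector `ξᵢ = εᵢ / √xᵢ` is conormal to the hypersurface at `x`: it satisfies
`xᵢ ξᵢ² = 1 = (∑ⱼ xⱼ ξⱼ)²`. -/
lemma mem_singularLocus_of_sign (a b : ℂ) (c : Fin m → ℂ) {z r : Fin m → ℂ}
    (hr : ∀ i, r i ^ 2 = z i) (hz : ∀ i, z i ≠ 0) (ε : Fin m → ℤˣ)
    (h : 1 + ∑ j, ((ε j : ℤ) : ℂ) * r j = 0) :
    z ∈ singularLocus (lauricellaIdeal a b c) := by
  obtain ⟨o⟩ : Nonempty (Fin m) := by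
    by_contra hne
    rw [not_nonempty_iff] at hne
    simp at h
  have hr0 : ∀ i, r i ≠ 0 := fun i h0 => hz i (by rw [← hr, h0, zero_pow two_ne_zero])
  have hεsq : ∀ i, ((ε i : ℤ) : ℂ) ^ 2 = 1 := by
    intro i
    rcases Int.units_eq_one_or (ε i) with h | h <;> simp [h]
  have hε0 : ∀ i, ((ε i : ℤ) : ℂ) ≠ 0 := fun i h0 => by
    have := hεsq i
    rw [h0] at this
    norm_num at this
  let ξ : Fin m → ℂ := fun i => ((ε i : ℤ) : ℂ) / r i
  have hzξ : ∀ i, z i * ξ i = ((ε i : ℤ) : ℂ) * r i := by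
    intro i
    have := hr0 i
    rw [← hr i]
    simp only [ξ]
    field_simp
  have hzξ2 : ∀ i, ξ i * (z i * ξ i) = 1 := by
    intro i
    rw [hzξ, ← hεsq i]
    have := hr0 i
    simp only [ξ]
    field_simp
  have hsum : ∑ i, z i * ξ i = -1 := by
    simp only [hzξ]
    linear_combination h
  have hA : ∀ i, lineEval z ξ (X (Sum.inr i) * (X (Sum.inl i) * X (Sum.inr i))) =
      Polynomial.X ^ 2 := by
    intro i
    have h₁ := congrArg Polynomial.C (hzξ2 i)
    simp only [map_mul, map_one] at h₁
    simp only [lineEval, map_mul, aeval_X, Sum.elim_inl, Sum.elim_inr]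
    linear_combination Polynomial.X ^ 2 * h₁
  have hs : lineEval z ξ (eulerSymbol m) = -Polynomial.X := by
    have h₁ := congrArg Polynomial.C hsum
    simp only [map_sum, map_mul, map_neg, map_one] at h₁
    simp only [lineEval, eulerSymbol, map_sum, map_mul, aeval_X, Sum.elim_inl, Sum.elim_inr,
      ← mul_assoc]
    rw [← Finset.sum_mul, h₁]
    ring
  refine ⟨(z, ξ), ⟨mem_characteristicVariety a b c o fun i => ?_, fun h0 => ?_⟩, rfl⟩
  · rw [generatorSymbol, map_add, map_smul, hA, neg_one_smul]
    split_ifs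
    · rw [map_mul, hs]
      ring
    · rw [hA]
      ring
  · exact div_ne_zero (hε0 o) (hr0 o) (congrFun h0 o)

end Lauricella

end

theorem mainTheorem3 (m : ℕ) (a b : ℂ) (c : Fin m → ℂ)
    (sqrt : ℂ → ℂ) (hsqrt : ∀ z, sqrt z ^ 2 = z) :
    Lauricella.singularLocus (Lauricella.lauricellaIdeal a b c) ∩ Lauricella.complexTorus m =
      {z : Fin m → ℂ | (∏ i, z i) *
          ∏ ε : Fin m → ℤˣ, (1 + ∑ j, ((ε j : ℤ) : ℂ) * sqrt (z j)) = 0} ∩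
        Lauricella.complexTorus m := by
  ext z
  refine and_congr_left fun (hz : ∀ i, z i ≠ 0) => ?_
  have hr : ∀ i, sqrt (z i) ^ 2 = z i := fun i => hsqrt (z i)
  constructor
  · intro h
    obtain ⟨ε, hε⟩ := Lauricella.exists_sign_of_mem_singularLocus hr hz h
    exact mul_eq_zero_of_right _ (Finset.prod_eq_zero (Finset.mem_univ ε) hε)
  · intro h
    obtain ⟨ε, -, hε⟩ := Finset.prod_eq_zero_iff.1
      ((mul_eq_zero.1 h).resolve_left (Finset.prod_ne_zero_iff.2 fun i _ => hz i))
    exact Lauricella.mem_singularLocus_of_sign a b c hr hz ε hε
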